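/- A *standard quantum circuit under $G$ constraint*, for a graph $G$ whose vertices are the qubits, is a sequence of layers; each layer consists of gates acting on pairwise disjoint sets of qubits, and each gate is either an arbitrary single-qubit unitary or a CNOT whose control and target are adjacent in $G$. Its *depth* is the number of layers and its *size* the number of gates. If $n$ of the $n+m$ qubits are designated as input and the other $m$ are ancillary, a circuit $C$ *prepares* an $n$-qubit state $|\psi\rangle$ if $C|0^n\rangle|0^m\rangle=|\psi\rangle|0^m\rangle$, and *implements* an $n$-qubit unitary $U$ if $C|x\rangle|0^m\rangle=(U|x\rangle)|0^m\rangle$ for all $x\in\{0,1\}^n$. Let $\mathrm{Grid}_{n+m}^{n_1,\dots,n_d}$ be the $d$-dimensional $n_1\times\cdots\times n_d$ grid graph, where $d\ge 1$, $n_1\ge\cdots\ge n_d\ge1$, $\prod_i n_i=n+m$, $n\ge 1$ and $m\ge 0$. The $n$ input qubits lie in the corner sub-grid $[n_1]\times\cdots\times[n_{k-1}]\times[n_k']\times\{1\}\times\cdots\times\{1\}$, where $k$ is the least index with $n_1\cdots n_k\ge n$ and $n_k'$ is the least integer with $n_1\cdots n_{k-1}n_k'\ge n$. For $d=1$ the grid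 is the path $\mathrm{Path}_{n+m}$, with its first $n$ vertices as input. Diagonal unitaries are normalised to have first diagonal entry $1$. There is an absolute constant $c>0$ such that the following hold for all such $d,n,m,n_1,\dots,n_d$ and every such placement of the input qubits. 1. Put $B_\beta=n+\beta^{\frac{n}{d+1}}+\max_{1\le j\le d}\dfrac{\beta^{n/j}}{\left(\prod_{i=j}^d n_i\right)^{1/j}}$. There exist an $n$-qubit state and an $n$-qubit diagonal unitary such that every circuit under $\mathrm{Grid}_{n+m}^{n_1,\dots,n_d}$ constraint with $m$ ancillary qubits that prepares the state (respectively implements the diagonal unitary) has depth at least $c\,B_2$. There exists an $n$-qubit unitary such that every such circuit implementing it has depth at least $c\,B_4$. 2. In particular, for $d=2$ the required depth is at least $c\left(2^{n/3}+\frac{2^{n/2}}{n_2^{1/2}}+\frac{2^n}{n+m}\right)$ for some state and for some diagonal unitary, and at least $c\left(4^{n/3}+\frac{4^{n/2}}{n_2^{1/2}}+\frac{4^n}{n+m}\right)$ for some unitary. 3. On $\mathrm{Path}_{n+m}$ the required depth is at least $c\left(2^{n/2}+\frac{2^n}{n+m}\right)$ for some state and for some diagonal unitary, and at least $c\left(2^{n}+\frac{4^n}{n+m}\right)$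 for some unitary; the required size is at least $c\,2^n$ for some state and for some diagonal unitary, and at least $c\,4^n$ for some unitary. -/

import Mathlib

namespace QCircuit

/-- An unnormalised pure state of qubits labelled by `V`: the amplitude of every basis string. -/
abbrev State (V : Type*) : Type _ := (V → Bool) → ℂ

/-- The elementary gates of standard quantum circuits under the constraint graph `G`: arbitrary
single-qubit unitaries, and CNOT gates with control `u` and target `v` along the edges of `G`. -/
inductive Gate {V : Type*} (G : SimpleGraph V) : Type _
  | single (v : V) (U : Matrix.unitaryGroup Bool ℂ) : Gate G
  | cnot (u v : V) (h : G.Adj u v) : Gate G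

section Circuits

variable {V : Type*} [DecidableEq V] {G : SimpleGraph V}

/-- The qubits on which a gate acts. -/
def Gate.qubits : Gate G → Finset V
  | .single v _ => {v}
  | .cnot u v _ => {u, v}

/-- The action of a gate on amplitudes. Since `u ≠ v`, the map `x ↦ x[v := x u ⊕ x v]` is an
involution of the basis strings, so the second line is `|x⟩ ↦ |x[v := x u ⊕ x v]⟩`. -/
def Gate.apply : Gate G → State V → State V
  | .single v U, ψ => fun x =>
      ∑ b : Bool, (U : Matrix Bool Bool ℂ) (x v) b * ψ (Function.update x v b)
  | .cnot u v _, ψ => fun x => ψ (Function.update x v (xor (x u) (x v)))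

/-- A depth-one layer: gates acting on pairwise disjoint sets of qubits. -/
structure Layer {V : Type*} [DecidableEq V] (G : SimpleGraph V) where
  gates : List (Gate G)
  disjoint : gates.Pairwise fun g h => Disjoint g.qubits h.qubits

/-- The action of a layer (its gates commute, so their order is immaterial). -/
def Layer.apply (L : Layer G) (ψ : State V) : State V :=
  L.gates.foldl (fun φ g => g.apply φ) ψ

/-- A circuit under `G` constraint: a sequence of layers, the first one being applied first. -/
abbrev Circuit {V : Type*} [DecidableEq V] (G : SimpleGraph V) : Type _ := List (Layer G)

/-- The number of layers. -/
def Circuit.depth (C : Circuit G) : ℕ := C.length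

/-- The number of gates. -/
def Circuit.size (C : Circuit G) : ℕ := (C.map fun L => L.gates.length).sum

/-- The action of a circuit. -/
def Circuit.apply (C : Circuit G) (ψ : State V) : State V :=
  C.foldl (fun φ L => L.apply φ) ψ

variable {n : ℕ}

open Classical in
/-- `|φ⟩|0^m⟩`: the `n`-qubit state `φ` on the input qubits `inp 0, …, inp (n-1)`, and all the
remaining (ancillary) qubits in the state `|0⟩`. -/
noncomputable def withAncilla (inp : Fin n ↪ V) (φ : State (Fin n)) : State V :=
  fun x => if ∀ v, v ∉ Set.range inp → x v = false then φ (fun q => x (inp q)) else 0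

/-- The `n`-qubit computational basis state `|x⟩`. -/
def ket (x : Fin n → Bool) : State (Fin n) := Pi.single x 1

/-- `C |0^n⟩|0^m⟩ = |ψ⟩|0^m⟩`. -/
def Circuit.Prepares (C : Circuit G) (inp : Fin n ↪ V) (ψ : State (Fin n)) : Prop :=
  C.apply (withAncilla inp (ket fun _ => false)) = withAncilla inp ψ

/-- `C |x⟩|0^m⟩ = (U|x⟩)|0^m⟩` for every basis string `x`. -/
def Circuit.Implements (C : Circuit G) (inp : Fin n ↪ V)
    (U : Matrix (Fin n → Bool) (Fin n → Bool) ℂ) : Prop :=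
  ∀ x : Fin n → Bool, C.apply (withAncilla inp (ket x)) = withAncilla inp (U.mulVec (ket x))

/-- The diagonal unitary `|x⟩ ↦ e^{iθ(x)}|x⟩`. -/
noncomputable def diagUnitary (θ : (Fin n → Bool) → ℝ) :
    Matrix (Fin n → Bool) (Fin n → Bool) ℂ :=
  Matrix.diagonal fun x => Complex.exp (Complex.I * (θ x : ℂ))

/-- Some `n`-qubit state can only be prepared, under `G` constraint with input qubits `inp` and all
other qubits ancillary, by circuits whose cost (depth or size) is at least `b`. -/
def SomeStateNeeds (G : SimpleGraph V) (inp : Fin n ↪ V) (cost : Circuit G → ℕ) (b : ℝ) : Prop :=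
  ∃ ψ : State (Fin n), ∑ x, ‖ψ x‖ ^ 2 = 1 ∧
    ∀ C : Circuit G, C.Prepares inp ψ → b ≤ (cost C : ℝ)

/-- The same for implementing some `n`-qubit diagonal unitary (with first diagonal entry `1`). -/
def SomeDiagonalNeeds (G : SimpleGraph V) (inp : Fin n ↪ V) (cost : Circuit G → ℕ) (b : ℝ) :
    Prop :=
  ∃ θ : (Fin n → Bool) → ℝ, θ (fun _ => false) = 0 ∧
    ∀ C : Circuit G, C.Implements inp (diagUnitary θ) → b ≤ (cost C : ℝ)

/-- The same for implementing some `n`-qubit unitary. -/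
def SomeUnitaryNeeds (G : SimpleGraph V) (inp : Fin n ↪ V) (cost : Circuit G → ℕ) (b : ℝ) : Prop :=
  ∃ U : Matrix.unitaryGroup (Fin n → Bool) ℂ,
    ∀ C : Circuit G, C.Implements inp (U : Matrix (Fin n → Bool) (Fin n → Bool) ℂ) →
      b ≤ (cost C : ℝ)

end Circuits

/-- The vertices of the `N 0 × ⋯ × N (d-1)` grid, with coordinates starting at `0`. -/
abbrev GridVertex {d : ℕ} (N : Fin d → ℕ) : Type := (i : Fin d) → Fin (N i)

/-- The `N 0 × ⋯ × N (d-1)` grid: two vertices are adjacent when they differ in exactly one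
coordinate, and there by exactly one. -/
def gridGraph {d : ℕ} (N : Fin d → ℕ) : SimpleGraph (GridVertex N) where
  Adj x y := ∃ k, (∀ l, l ≠ k → x l = y l) ∧
    ((x k : ℕ) + 1 = (y k : ℕ) ∨ (y k : ℕ) + 1 = (x k : ℕ))
  symm := ⟨fun _ _ ⟨k, h, h'⟩ => ⟨k, fun l hl => (h l hl).symm, h'.symm⟩⟩
  loopless := ⟨fun _ ⟨_, _, h'⟩ => by omega⟩

/-- The corner sub-grid `[n₁] × ⋯ × [n_{k-1}] × [n'_k] × {1} × ⋯ × {1}` that holds the `n` input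
qubits: `k` is the least index with `n₁ ⋯ n_k ≥ n`, and `n'_k` is the least number with
`n₁ ⋯ n_{k-1} n'_k ≥ n`. For `d = 1` these are the first `n` vertices of the path. -/
def inputCorner {d : ℕ} (N : Fin d → ℕ) (n : ℕ) : Set (GridVertex N) :=
  {x | ∃ (k : Fin d) (a : ℕ),
    IsLeast {k : Fin d | n ≤ ∏ i ∈ Finset.Iic k, N i} k ∧
    IsLeast {a : ℕ | n ≤ (∏ i ∈ Finset.Iio k, N i) * a} a ∧
    (x k : ℕ) < a ∧ ∀ i, k < i → (x i : ℕ) = 0}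

/-- `n + β^{n/(d+1)} + max_{j ∈ [d]} β^{n/j} / (n_j ⋯ n_d)^{1/j}`, where the 1-based index `j` of
the formula is `j + 1` for `j : Fin d`. -/
noncomputable def gridBound (β : ℝ) {d : ℕ} (N : Fin d → ℕ) (n : ℕ) : ℝ :=
  (n : ℝ) + β ^ ((n : ℝ) / ((d : ℝ) + 1)) +
    ⨆ j : Fin d, β ^ ((n : ℝ) / ((j : ℝ) + 1)) /
      (∏ i ∈ Finset.Ici j, (N i : ℝ)) ^ (1 / ((j : ℝ) + 1))

end QCircuit

/-! Parameter counting, restricted to a light cone. A circuit factors into the gates in the backward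
light cone of the input qubits, followed by gates on ancillas alone (`Circuit.exists_lightCone`).
Undoing the latter shows that the target is, up to a scalar, a slice of the state produced by the
`q` cone gates (`readsOff_of_factor`). Relaxing single-qubit unitaries to arbitrary 2×2 matrices,
sequences of `q` gates form countably many smooth families with `8q` real parameters; the scalar
adds 2. These families have Hausdorff dimension at most `8q + 2`, so they cannot cover a
`K`-dimensional family of targets when `8q + 2 < K` (`exists_generic`). Here `K = 2^n - 1` for free
phases (states, diagonals) and `K = 2·4^(n-1)` for unitaries with a free corner block.

For depth `D`, the cone at most doubles per layer, so `q ≤ n·2^D`, which forces `n = O(D)`. On a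
grid all input coordinates are below `n`, so `r` layers back the cone lies in a box of side `n + r =
O(D)`. Bounding the first `j` coordinates by the box and the others by the grid gives `q ≤
D·O(D)^j·∏_{i ≥ j} N i`, with indices from 0 (`Circuit.Demands.pow_le_depth`). The cases `j < d`
yield the maximum in the bound, and `j = d` yields `β^(n/(d+1))`. -/

namespace QCircuit

/-! ### Commuting gates and the backward light cone. -/

section Circuits

variable {V : Type*} [DecidableEq V] {G : SimpleGraph V}

/-- The successive action of a list of gates, the first one being applied first. -/
def runGates (l : List (Gate G)) (ψ : State V) : State V :=
  l.foldl (fun φ g => g.apply φ) ψ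

@[simp] lemma runGates_nil (ψ : State V) : runGates ([] : List (Gate G)) ψ = ψ := rfl

@[simp] lemma runGates_cons (g : Gate G) (l : List (Gate G)) (ψ : State V) :
    runGates (g :: l) ψ = runGates l (g.apply ψ) := rfl

lemma runGates_append (l l' : List (Gate G)) (ψ : State V) :
    runGates (l ++ l') ψ = runGates l' (runGates l ψ) := by
  simp [runGates, List.foldl_append]

/-- All the gates of a circuit, in order. -/
def Circuit.gateList (C : Circuit G) : List (Gate G) := C.flatMap Layer.gates

lemma Circuit.apply_eq_runGates (C : Circuit G) (ψ : State V) :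
    C.apply ψ = runGates C.gateList ψ := by
  induction C generalizing ψ with
  | nil => rfl
  | cons L C ih =>
    have : Circuit.gateList (L :: C) = L.gates ++ Circuit.gateList C := by
      simp [Circuit.gateList]
    rw [this, runGates_append, ← ih]
    rfl

lemma Circuit.length_gateList (C : Circuit G) : C.gateList.length = C.size := by
  simp [Circuit.gateList, Circuit.size, List.length_flatMap]

lemma Gate.apply_comm {g h : Gate G} (hd : Disjoint g.qubits h.qubits) (ψ : State V) :
    g.apply (h.apply ψ) = h.apply (g.apply ψ) := by
  cases g with
  | single v U =>
    cases h with
    | single w W =>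
      have hvw : v ≠ w := by simpa [Gate.qubits] using hd
      funext x
      simp only [Gate.apply, Function.update_of_ne hvw, Function.update_of_ne hvw.symm,
        Finset.mul_sum]
      rw [Finset.sum_comm]
      refine Finset.sum_congr rfl fun a _ => Finset.sum_congr rfl fun b _ => ?_
      rw [Function.update_comm hvw]
      ring
    | cnot a b hab =>
      have hv : v ≠ a ∧ v ≠ b := by simpa [Gate.qubits] using hd
      funext x
      simp only [Gate.apply, Function.update_of_ne hv.2,
        Function.update_of_ne hv.1.symm, Function.update_of_ne hv.2.symm]
      refine Finset.sum_congr rfl fun c _ => ?_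
      rw [Function.update_comm hv.2]
  | cnot u v huv =>
    cases h with
    | single w W =>
      have hv : u ≠ w ∧ v ≠ w := by
        simpa [Gate.qubits, eq_comm] using hd
      funext x
      simp only [Gate.apply, Function.update_of_ne hv.1, Function.update_of_ne hv.2,
        Function.update_of_ne hv.2.symm]
      refine Finset.sum_congr rfl fun c _ => ?_
      rw [Function.update_comm hv.2]
    | cnot a b hab =>
      have hv : (u ≠ a ∧ v ≠ a) ∧ u ≠ b ∧ v ≠ b := by
        simpa [Gate.qubits, eq_comm, and_assoc] using hd
      obtain ⟨⟨h1, h2⟩, h3, h4⟩ := hv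
      funext x
      simp only [Gate.apply, Function.update_of_ne h3, Function.update_of_ne h4,
        Function.update_of_ne h2.symm, Function.update_of_ne h4.symm]
      rw [Function.update_comm h4]

lemma Gate.apply_runGates_comm {g : Gate G} {l : List (Gate G)}
    (hd : ∀ h ∈ l, Disjoint g.qubits h.qubits) (ψ : State V) :
    g.apply (runGates l ψ) = runGates l (g.apply ψ) := by
  induction l generalizing ψ with
  | nil => rfl
  | cons h l ih =>
    rw [runGates_cons, runGates_cons, ih fun k hk => hd k (List.mem_cons_of_mem _ hk),
      Gate.apply_comm (hd h List.mem_cons_self)]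

lemma runGates_comm {l l' : List (Gate G)}
    (hd : ∀ g ∈ l, ∀ h ∈ l', Disjoint g.qubits h.qubits) (ψ : State V) :
    runGates l (runGates l' ψ) = runGates l' (runGates l ψ) := by
  induction l generalizing ψ with
  | nil => rfl
  | cons g l ih =>
    rw [runGates_cons, runGates_cons, Gate.apply_runGates_comm (hd g List.mem_cons_self),
      ih fun k hk => hd k (List.mem_cons_of_mem _ hk)]

/-- The gates of a layer that act on some qubit of `S`. -/
def Layer.touching (L : Layer G) (S : Finset V) : List (Gate G) :=
  L.gates.filter fun g => ¬ Disjoint g.qubits S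

/-- The gates of a layer that act on no qubit of `S`. -/
def Layer.avoiding (L : Layer G) (S : Finset V) : List (Gate G) :=
  L.gates.filter fun g => Disjoint g.qubits S

lemma Layer.apply_eq (L : Layer G) (S : Finset V) (ψ : State V) :
    L.apply ψ = runGates (L.avoiding S) (runGates (L.touching S) ψ) := by
  have hperm : L.gates.Perm (L.touching S ++ L.avoiding S) := by
    have := List.filter_append_perm (fun g : Gate G => decide (¬ Disjoint g.qubits S)) L.gates
    simpa [Layer.touching, Layer.avoiding] using this.symm
  rw [← runGates_append]
  refine hperm.foldl_eq' ?_ ψ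
  intro g hg h hh z
  have : Std.Symm fun g h : Gate G => g.apply (h.apply z) = h.apply (g.apply z) :=
    ⟨fun _ _ h => h.symm⟩
  exact List.Pairwise.forall_of_forall
    (R := fun g h : Gate G => g.apply (h.apply z) = h.apply (g.apply z)) (fun _ _ => rfl)
    (L.disjoint.imp fun hd => Gate.apply_comm hd z) hh hg

lemma Gate.card_qubits_le (g : Gate G) : g.qubits.card ≤ 2 := by
  cases g with
  | single v U => simp [Gate.qubits]
  | cnot u v h => exact Finset.card_le_two

/-- The union of the qubit sets of a list of gates. -/
def gatesQubits (l : List (Gate G)) : Finset V :=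
  l.foldr (fun g s => g.qubits ∪ s) ∅

lemma mem_gatesQubits {l : List (Gate G)} {v : V} :
    v ∈ gatesQubits l ↔ ∃ g ∈ l, v ∈ g.qubits := by
  induction l with
  | nil => simp [gatesQubits]
  | cons g l ih =>
    have : gatesQubits (g :: l) = g.qubits ∪ gatesQubits l := rfl
    simp [this, ih]

/-- Pairwise disjoint gates that all touch `S`: there are at most `|S|` of them, and they enlarge
`S` to a set of at most twice its size. -/
lemma length_add_card_union_le {l : List (Gate G)} {S : Finset V}
    (hl : l.Pairwise fun g h => Disjoint g.qubits h.qubits)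
    (hS : ∀ g ∈ l, ¬ Disjoint g.qubits S) :
    l.length ≤ (S ∩ gatesQubits l).card ∧ (gatesQubits l \ S).card ≤ l.length := by
  induction l with
  | nil => simp [gatesQubits]
  | cons g l ih =>
    obtain ⟨h1, h2⟩ := ih hl.of_cons fun h hh => hS h (List.mem_cons_of_mem _ hh)
    have hq : gatesQubits (g :: l) = g.qubits ∪ gatesQubits l := rfl
    obtain ⟨v, hvg, hvS⟩ := Finset.not_disjoint_iff.1 (hS g List.mem_cons_self)
    have hvl : v ∉ gatesQubits l := by
      rw [mem_gatesQubits]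
      rintro ⟨h, hh, hv⟩
      exact Finset.disjoint_left.1 (List.rel_of_pairwise_cons hl hh) hvg hv
    constructor
    · have : insert v (S ∩ gatesQubits l) ⊆ S ∩ gatesQubits (g :: l) := by
        rw [hq]
        intro w hw
        simp only [Finset.mem_insert, Finset.mem_inter, Finset.mem_union] at hw ⊢
        rcases hw with rfl | hw
        · exact ⟨hvS, Or.inl hvg⟩
        · exact ⟨hw.1, Or.inr hw.2⟩
      have h3 := Finset.card_le_card this
      rw [Finset.card_insert_of_notMem (by simp [hvl])] at h3
      rw [List.length_cons]
      omega
    · have h4 : gatesQubits (g :: l) \ S ⊆ (g.qubits.erase v) ∪ (gatesQubits l \ S) := by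
        rw [hq]
        intro w hw
        simp only [Finset.mem_sdiff, Finset.mem_union, Finset.mem_erase] at hw ⊢
        rcases hw with ⟨hw | hw, hwS⟩
        · exact Or.inl ⟨fun h => hwS (h ▸ hvS), hw⟩
        · exact Or.inr ⟨hw, hwS⟩
      have h5 := (Finset.card_le_card h4).trans (Finset.card_union_le _ _)
      rw [Finset.card_erase_of_mem hvg] at h5
      have := g.card_qubits_le
      rw [List.length_cons]
      omega

lemma Gate.adj_of_mem_qubits {g : Gate G} {u v : V} (hu : u ∈ g.qubits) (hv : v ∈ g.qubits)
    (huv : u ≠ v) : G.Adj u v := by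
  cases g with
  | single w U =>
    simp only [Gate.qubits, Finset.mem_singleton] at hu hv
    exact absurd (hu.trans hv.symm) huv
  | cnot a b h =>
    simp only [Gate.qubits, Finset.mem_insert, Finset.mem_singleton] at hu hv
    rcases hu with rfl | rfl <;> rcases hv with rfl | rfl
    · exact absurd rfl huv
    · exact h
    · exact h.symm
    · exact absurd rfl huv

/-- The backward light cone of `S`: a circuit is a sequence of gates in the cone followed by gates
that do not act on `S`, and the number of the former is bounded by the growth of the cone. -/
theorem Circuit.exists_lightCone (C : Circuit G) (S : Finset V) :
    ∃ kept rest : List (Gate G),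
      (∀ ψ, C.apply ψ = runGates rest (runGates kept ψ)) ∧
      (∀ g ∈ rest, Disjoint g.qubits S) ∧
      kept.length ≤ S.card * 2 ^ C.depth ∧
      ∀ A : ℕ → Finset V, S ⊆ A 0 →
        (∀ r, ∀ u ∈ A r, u ∈ A (r + 1) ∧ ∀ v, G.Adj u v → v ∈ A (r + 1)) →
        kept.length ≤ ∑ r ∈ Finset.range C.depth, (A r).card := by
  -- The extra `S.card` on the left makes the exponential bound inductive.
  suffices H : ∃ kept rest : List (Gate G),
      (∀ ψ, C.apply ψ = runGates rest (runGates kept ψ)) ∧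
      (∀ g ∈ rest, Disjoint g.qubits S) ∧
      kept.length + S.card ≤ S.card * 2 ^ C.depth ∧
      ∀ A : ℕ → Finset V, S ⊆ A 0 →
        (∀ r, ∀ u ∈ A r, u ∈ A (r + 1) ∧ ∀ v, G.Adj u v → v ∈ A (r + 1)) →
        kept.length ≤ ∑ r ∈ Finset.range C.depth, (A r).card by
    obtain ⟨k, r, h1, h2, h3, h4⟩ := H
    exact ⟨k, r, h1, h2, by omega, h4⟩
  -- The cone is built from the output backwards: the last layer is peeled off, and the earlier
  -- layers are treated with `S` enlarged by every qubit that this layer couples to it.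
  induction C using List.reverseRecOn generalizing S with
  | nil => exact ⟨[], [], fun ψ => rfl, by simp, by simp [Circuit.depth], by simp⟩
  | append_singleton C L ih =>
    obtain ⟨k, r, h1, h2, h3, h4⟩ := ih (S ∪ gatesQubits (L.touching S))
    have hdep : Circuit.depth (C ++ [L]) = Circuit.depth C + 1 := by simp [Circuit.depth]
    obtain ⟨h5, h6⟩ := length_add_card_union_le (l := L.touching S) (S := S)
      (L.disjoint.filter _) (fun g hg => by simpa using (List.mem_filter.1 hg).2)
    have h7 : (L.touching S).length ≤ S.card :=
      h5.trans (Finset.card_le_card Finset.inter_subset_left)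
    have h8 : (S ∪ gatesQubits (L.touching S)).card = S.card +
        (gatesQubits (L.touching S) \ S).card := by
      rw [← Finset.union_sdiff_self_eq_union,
        Finset.card_union_of_disjoint Finset.disjoint_sdiff]
    refine ⟨k ++ L.touching S, r ++ L.avoiding S, fun ψ => ?_, ?_, ?_, ?_⟩
    · have : Circuit.apply (C ++ [L]) ψ = L.apply (Circuit.apply C ψ) := by
        simp [Circuit.apply, List.foldl_append]
      rw [this, h1, L.apply_eq S, runGates_append, runGates_append]
      congr 1
      -- The discarded earlier gates avoid the enlarged set, hence all qubits of the touching gates,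
      -- and can be moved after them.
      refine runGates_comm (fun g hg h hh => ?_) _
      refine Finset.disjoint_left.2 fun v hv hv' => Finset.disjoint_left.1 (h2 h hh) hv' ?_
      exact Finset.mem_union_right _ (mem_gatesQubits.2 ⟨g, hg, hv⟩)
    · intro g hg
      rcases List.mem_append.1 hg with hg | hg
      · exact (h2 g hg).mono_right Finset.subset_union_left
      · simpa using (List.mem_filter.1 hg).2
    · rw [List.length_append, hdep, pow_succ]
      set a := (gatesQubits (L.touching S) \ S).card
      rw [h8] at h3
      have : (S.card + a) * 2 ^ Circuit.depth C ≤ (S.card + S.card) * 2 ^ Circuit.depth C :=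
        Nat.mul_le_mul_right _ (by omega)
      -- The layer has at most `|S|` touching gates and adds `a ≤ |S|` qubits; the slack `|S| - a`
      -- tops the inductive bound up to `2|S|`.
      have h9 : k.length + (S.card + a) +
          (S.card - a) * 1 ≤ (S.card + a) * 2 ^ Circuit.depth C +
            (S.card - a) * 2 ^ Circuit.depth C :=
        Nat.add_le_add h3 (Nat.mul_le_mul_left _ Nat.one_le_two_pow)
      rw [← add_mul, show S.card + a + (S.card - a) = S.card * 2 by omega] at h9
      calc _ ≤ k.length + (S.card + a) + (S.card - a) * 1 := by omega
        _ ≤ _ := h9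
        _ = _ := by ring
    · intro A hA hstep
      rw [List.length_append, hdep, Finset.sum_range_succ', add_comm]
      have h9 := h4 (fun r => A (r + 1)) ?_ fun r => hstep (r + 1)
      · have := Finset.card_le_card hA
        omega
      · intro v hv
        rcases Finset.mem_union.1 hv with hv | hv
        · exact (hstep 0 v (hA hv)).1
        · obtain ⟨g, hg, hvg⟩ := mem_gatesQubits.1 hv
          have : ¬ Disjoint g.qubits S := by simpa using (List.mem_filter.1 hg).2
          obtain ⟨u, hug, huS⟩ := Finset.not_disjoint_iff.1 this
          rcases eq_or_ne u v with rfl | huv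
          · exact (hstep 0 u (hA huS)).1
          · exact (hstep 0 u (hA huS)).2 v (Gate.adj_of_mem_qubits hug hvg huv)

end Circuits

end QCircuit

namespace QCircuit

/-! ### Removing the gates that act on ancillas only. -/

section Circuits

variable {V : Type*} [DecidableEq V] {G : SimpleGraph V} {n : ℕ}

/-- The inverse gate. -/
def Gate.inv : Gate G → Gate G
  | .single v U => .single v U⁻¹
  | .cnot u v h => .cnot u v h

@[simp] lemma Gate.qubits_inv (g : Gate G) : g.inv.qubits = g.qubits := by
  cases g <;> rfl

lemma Gate.inv_apply_apply (g : Gate G) (ψ : State V) : g.inv.apply (g.apply ψ) = ψ := by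
  cases g with
  | single v U =>
    funext x
    have hU : ((U⁻¹ : Matrix.unitaryGroup Bool ℂ) : Matrix Bool Bool ℂ) *
        (U : Matrix Bool Bool ℂ) = 1 := by
      rw [← Submonoid.coe_mul, inv_mul_cancel, Submonoid.coe_one]
    simp only [Gate.inv, Gate.apply, Function.update_self, Function.update_idem, Finset.mul_sum,
      ← mul_assoc]
    rw [Finset.sum_comm]
    simp only [← Finset.sum_mul, ← Matrix.mul_apply, hU, Matrix.one_apply]
    simp
  | cnot u v h =>
    funext x
    simp [Gate.inv, Gate.apply, Function.update_of_ne h.ne]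

/-- Running the inverse gates in the opposite order. -/
def invGates (l : List (Gate G)) : List (Gate G) := (l.map Gate.inv).reverse

lemma runGates_invGates (l : List (Gate G)) (ψ : State V) :
    runGates (invGates l) (runGates l ψ) = ψ := by
  induction l generalizing ψ with
  | nil => rfl
  | cons g l ih =>
    have : invGates (g :: l) = invGates l ++ [g.inv] := by simp [invGates]
    rw [this, runGates_append, runGates_cons g, ih]
    exact g.inv_apply_apply ψ

lemma Gate.apply_zero (g : Gate G) : g.apply (0 : State V) = 0 := by
  cases g <;> funext x <;> simp [Gate.apply]

lemma runGates_zero (l : List (Gate G)) : runGates l (0 : State V) = 0 := by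
  induction l with
  | nil => rfl
  | cons g l ih => rw [runGates_cons, g.apply_zero, ih]

/-- A gate off the input never changes the input bits, so a factor depending only on them behaves as
a scalar. -/
lemma Gate.apply_comp_mul {g : Gate G} {inp : Fin n ↪ V} (hg : ∀ q, inp q ∉ g.qubits)
    (t : State (Fin n)) (φ : State V) :
    g.apply (fun x => t (fun q => x (inp q)) * φ x) =
      fun x => t (fun q => x (inp q)) * g.apply φ x := by
  have key : ∀ v ∈ g.qubits, ∀ (x : V → Bool) (b : Bool),
      (fun q => Function.update x v b (inp q)) = fun q => x (inp q) := by
    intro v hv x b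
    funext q
    exact Function.update_of_ne (by rintro rfl; exact hg q hv) _ _
  cases g with
  | single v U =>
    funext x
    simp only [Gate.apply, key v (by simp [Gate.qubits]), Finset.mul_sum]
    exact Finset.sum_congr rfl fun b _ => by ring
  | cnot u v h =>
    funext x
    simp only [Gate.apply, key v (by simp [Gate.qubits])]

lemma runGates_comp_mul {l : List (Gate G)} {inp : Fin n ↪ V}
    (hl : ∀ g ∈ l, ∀ q, inp q ∉ g.qubits) (t : State (Fin n)) (φ : State V) :
    runGates l (fun x => t (fun q => x (inp q)) * φ x) =
      fun x => t (fun q => x (inp q)) * runGates l φ x := by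
  induction l generalizing φ with
  | nil => rfl
  | cons g l ih =>
    rw [runGates_cons, Gate.apply_comp_mul (hl g List.mem_cons_self),
      ih fun h hh => hl h (List.mem_cons_of_mem _ hh), runGates_cons]

/-- The amplitudes of `ψ` do not depend on the input qubits. -/
def IgnoresInput (inp : Fin n ↪ V) (ψ : State V) : Prop :=
  ∀ x y : V → Bool, (∀ v ∉ Set.range inp, x v = y v) → ψ x = ψ y

lemma Gate.ignoresInput {g : Gate G} {inp : Fin n ↪ V} (hg : ∀ q, inp q ∉ g.qubits)
    {ψ : State V} (hψ : IgnoresInput inp ψ) : IgnoresInput inp (g.apply ψ) := by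
  intro x y hxy
  have hq : ∀ v ∈ g.qubits, x v = y v := by
    intro v hv
    refine hxy v ?_
    rintro ⟨q, rfl⟩
    exact hg q hv
  have key : ∀ v b, ψ (Function.update x v b) = ψ (Function.update y v b) := by
    intro v b
    refine hψ _ _ fun w hw => ?_
    by_cases hwv : w = v
    · subst hwv; simp
    · simp [Function.update_of_ne hwv, hxy w hw]
  cases g with
  | single v U => simp only [Gate.apply, key, hq v (by simp [Gate.qubits])]
  | cnot u v h =>
    simp only [Gate.apply, key, hq v (by simp [Gate.qubits]), hq u (by simp [Gate.qubits])]

lemma runGates_ignoresInput {l : List (Gate G)} {inp : Fin n ↪ V}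
    (hl : ∀ g ∈ l, ∀ q, inp q ∉ g.qubits) {ψ : State V} (hψ : IgnoresInput inp ψ) :
    IgnoresInput inp (runGates l ψ) := by
  induction l generalizing ψ with
  | nil => exact hψ
  | cons g l ih =>
    exact ih (fun h hh => hl h (List.mem_cons_of_mem _ hh))
      (Gate.ignoresInput (hl g List.mem_cons_self) hψ)

omit [DecidableEq V] in
lemma extend_comp_emb (inp : Fin n ↪ V) (z : Fin n → Bool) (y : V → Bool) :
    (fun q => Function.extend inp z y (inp q)) = z :=
  funext fun q => inp.injective.extend_apply z y q

omit [DecidableEq V] in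
lemma withAncilla_extend (inp : Fin n ↪ V) (t : State (Fin n)) (z : Fin n → Bool) :
    withAncilla inp t (Function.extend inp z fun _ => false) = t z := by
  rw [withAncilla, if_pos, extend_comp_emb]
  intro v hv
  rw [Function.extend_apply']
  exact hv

omit [DecidableEq V] in
lemma withAncilla_injective (inp : Fin n ↪ V) :
    Function.Injective (withAncilla inp : State (Fin n) → State V) := by
  intro s t h
  funext z
  rw [← withAncilla_extend inp s z, h, withAncilla_extend]

/-- The targets `t j` can be read off, up to a common factor, from the action of the gates `l` on
the states `s j`, by fixing the values of the qubits outside the input to `y`. -/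
def ReadsOff {J : Type*} (inp : Fin n ↪ V) (l : List (Gate G)) (s : J → State V)
    (t : J → State (Fin n)) : Prop :=
  ∃ (y : V → Bool) (c : ℂ), ∀ j z, t j z = c * runGates l (s j) (Function.extend inp z y)

/-- The final states are `t j · φ₀`, with `φ₀` the indicator of zero ancillas. Inverting `rest` acts
on `φ₀` alone and yields `t j · φ`, where `φ` is nonzero and independent of `j` and of the input
bits; dividing by a nonzero value of `φ` recovers `t j`. -/
theorem readsOff_of_factor {J : Type*} {inp : Fin n ↪ V} {kept rest : List (Gate G)}
    (hrest : ∀ g ∈ rest, ∀ q, inp q ∉ g.qubits) {s : J → State V} {t : J → State (Fin n)}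
    (h : ∀ j, runGates rest (runGates kept (s j)) = withAncilla inp (t j)) :
    ReadsOff inp kept s t := by
  classical
  set φ₀ : State V := withAncilla inp fun _ => 1 with hφ₀
  have hig : IgnoresInput inp φ₀ := by
    intro x y hxy
    have : (∀ v, v ∉ Set.range inp → x v = false) ↔ (∀ v, v ∉ Set.range inp → y v = false) :=
      forall₂_congr fun v hv => by rw [hxy v hv]
    simp only [hφ₀, withAncilla, this]
  have hinv : ∀ g ∈ invGates rest, ∀ q, inp q ∉ g.qubits := by
    intro g hg q
    simp only [invGates, List.mem_reverse, List.mem_map] at hg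
    obtain ⟨g, hg, rfl⟩ := hg
    rw [Gate.qubits_inv]
    exact hrest g hg q
  set φ := runGates (invGates rest) φ₀ with hφ
  have hφ0 : φ ≠ 0 := by
    intro h0
    have hz : runGates (invGates (invGates rest)) φ = φ₀ := runGates_invGates _ _
    rw [h0, runGates_zero] at hz
    have := withAncilla_extend inp (fun _ => 1) fun _ => false
    rw [← hφ₀, ← hz] at this
    simp at this
  obtain ⟨y, hy⟩ := Function.ne_iff.1 hφ0
  refine ⟨y, (φ y)⁻¹, fun j z => ?_⟩
  have h1 : withAncilla inp (t j) = fun x => t j (fun q => x (inp q)) * φ₀ x := by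
    funext x
    simp only [hφ₀, withAncilla]
    split_ifs <;> simp
  have h2 := congrArg (runGates (invGates rest)) (h j)
  rw [runGates_invGates, h1, runGates_comp_mul hinv, ← hφ] at h2
  rw [h2]
  dsimp only
  rw [extend_comp_emb, show φ (Function.extend inp z y) = φ y from
    runGates_ignoresInput hinv hig _ _ ?_]
  · rw [mul_left_comm, inv_mul_cancel₀ (by simpa using hy), mul_one]
  · intro v hv
    rw [Function.extend_apply']
    exact hv

end Circuits

/-! ### Parameter counting by Hausdorff dimension. -/

section Dimension

universe u

variable {V : Type u} [DecidableEq V] {G : SimpleGraph V} {n : ℕ}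

/-- The action of a gate of given type and position, whose matrix entries are parameters. -/
def gateMap : V ⊕ V × V → (Bool → Bool → ℂ) → State V → State V
  | .inl v, U, ψ => fun x => ∑ b : Bool, U (x v) b * ψ (Function.update x v b)
  | .inr (u, v), _, ψ => fun x => ψ (Function.update x v (xor (x u) (x v)))

lemma Gate.exists_gateMap (g : Gate G) : ∃ i U, gateMap i U = g.apply := by
  cases g with
  | single v U => exact ⟨.inl v, U, rfl⟩
  | cnot u v h => exact ⟨.inr (u, v), 0, rfl⟩

lemma contDiff_gateMap [Fintype V] {E : Type*} [NormedAddCommGroup E] [NormedSpace ℝ E]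
    (i : V ⊕ V × V) {U : E → Bool → Bool → ℂ} {F : E → State V} (hU : ContDiff ℝ 1 U)
    (hF : ContDiff ℝ 1 F) : ContDiff ℝ 1 fun e => gateMap i (U e) (F e) := by
  rcases i with v | ⟨u, v⟩
  · simp only [gateMap]
    fun_prop
  · simp only [gateMap]
    fun_prop

/-- The states reachable from a given family with `q` gates are covered by countably many smooth
families with `4 q` complex parameters. -/
theorem exists_cover_runGates [Fintype V] {J : Type*} [Fintype J] (s : J → State V) (q : ℕ) :
    ∃ (ι : Type u) (_ : Countable ι) (F : ι → (Fin q → Bool → Bool → ℂ) → J → State V),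
      (∀ i, ContDiff ℝ 1 (F i)) ∧
      ∀ l : List (Gate G), l.length = q → ∃ i θ, F i θ = fun j => runGates l (s j) := by
  induction q with
  | zero =>
    refine ⟨PUnit, inferInstance, fun _ _ => s, fun _ => contDiff_const, fun l hl => ?_⟩
    rw [List.length_eq_zero_iff.1 hl]
    exact ⟨PUnit.unit, 0, rfl⟩
  | succ q ih =>
    obtain ⟨ι, hι, F, hF, hcov⟩ := ih
    refine ⟨ι × (V ⊕ V × V), inferInstance,
      fun i θ j => gateMap i.2 (θ (Fin.last q)) (F i.1 (fun k => θ k.castSucc) j), ?_, ?_⟩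
    · rintro ⟨i, k⟩
      refine contDiff_pi.2 fun j => contDiff_gateMap k (contDiff_apply ℝ _ _) ?_
      exact (contDiff_pi.1 (hF i) j).comp (contDiff_pi.2 fun a => contDiff_apply ℝ _ _)
    · intro l hl
      obtain ⟨l', g, rfl⟩ := List.eq_nil_or_concat' l |>.resolve_left (by rintro rfl; simp at hl)
      obtain ⟨i, θ, h⟩ := hcov l' (by simpa using hl)
      obtain ⟨k, U, hk⟩ := g.exists_gateMap
      refine ⟨(i, k), Fin.snoc (α := fun _ => Bool → Bool → ℂ) θ U, ?_⟩
      funext j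
      simp [h, hk, runGates_append]

/-- If the targets range over a set whose image under a smooth map `π` has nonempty interior, then
some target can only be read off from gate sequences with enough parameters. -/
theorem exists_generic [Fintype V] {J : Type*} [Fintype J] (inp : Fin n ↪ V) (s : J → State V)
    {E : Type*} [NormedAddCommGroup E] [NormedSpace ℝ E] [FiniteDimensional ℝ E]
    {π : (J → State (Fin n)) → E} (hπ : ContDiff ℝ 1 π) {R : Set E} (hR : (interior R).Nonempty)
    (hE : 0 < Module.finrank ℝ E) (e₀ : E) :
    ∃ r ∈ R, r ≠ e₀ ∧ ∀ t, π t = r → ∀ l : List (Gate G), ReadsOff inp l s t →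
      Module.finrank ℝ E ≤ 8 * l.length + 2 := by
  by_contra! hcon
  choose ι hι F hF hcov using exists_cover_runGates (G := G) s
  set K := Module.finrank ℝ E with hK
  -- The parameters are the scalar of `ReadsOff` and four complex entries per gate; the slice `y` is
  -- a discrete choice.
  let H (q : ℕ) (i : ι q) (y : V → Bool) (p : ℂ × (Fin q → Bool → Bool → ℂ)) : E :=
    π fun j z => p.1 * F q i p.2 j (Function.extend inp z y)
  have hH (q i y) : dimH (Set.range (H q i y)) ≤ ((8 * q + 2 : ℕ) : ENNReal) := by
    have h1 : ContDiff ℝ 1 (H q i y) := by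
      refine hπ.comp (contDiff_pi.2 fun j => contDiff_pi.2 fun z => contDiff_fst.mul ?_)
      exact contDiff_pi.1 (contDiff_pi.1 ((hF q i).comp contDiff_snd) j) _
    refine h1.dimH_range_le.trans ?_
    have : Module.finrank ℝ (ℂ × (Fin q → Bool → Bool → ℂ)) = 8 * q + 2 := by
      simp [Module.finrank_prod, Module.finrank_pi_fintype, Complex.finrank_real_complex]
      ring
    rw [this]
  let T := {q : ℕ // 8 * q + 2 < K}
  have hsub : R ⊆ {e₀} ∪ ⋃ (q : T) (i : ι q) (y : V → Bool), Set.range (H q i y) := by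
    intro r hr
    by_cases hre : r = e₀
    · exact Or.inl hre
    obtain ⟨t, ht, l, ⟨y, c, hl⟩, hlt⟩ := hcon r hr hre
    obtain ⟨i, θ, h⟩ := hcov l.length l rfl
    refine Or.inr (Set.mem_iUnion.2 ⟨⟨l.length, hlt⟩, Set.mem_iUnion.2 ⟨i,
      Set.mem_iUnion.2 ⟨y, ⟨(c, θ), ?_⟩⟩⟩⟩)
    rw [← ht]
    simp only [H, h]
    congr 1
    funext j z
    exact (hl j z).symm
  have h1 : dimH R ≤ ((K - 1 : ℕ) : ENNReal) := by
    refine (dimH_mono hsub).trans ?_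
    rw [dimH_union, dimH_singleton, dimH_iUnion]
    refine max_le zero_le (iSup_le fun q => ?_)
    rw [dimH_iUnion]
    refine iSup_le fun i => ?_
    rw [dimH_iUnion]
    refine iSup_le fun y => (hH q i y).trans ?_
    have := q.2
    exact_mod_cast (by omega : 8 * (q : ℕ) + 2 ≤ K - 1)
  rw [Real.dimH_of_nonempty_interior hR, ← hK] at h1
  have h2 : K ≤ K - 1 := by exact_mod_cast h1
  omega

end Dimension

end QCircuit

namespace QCircuit

/-! ### What a generic target forces on a circuit. -/

section Demands

variable {V : Type*} [DecidableEq V] {G : SimpleGraph V} {n : ℕ}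

/-- The resources that parameter counting forces on a circuit which has to realise a generic
member of a `K`-dimensional family of targets. -/
structure Circuit.Demands (C : Circuit G) (inp : Fin n ↪ V) (K : ℕ) : Prop where
  one_le_depth : 1 ≤ C.depth
  one_le_size : 1 ≤ C.size
  le_size : K ≤ 8 * C.size + 2
  le_cone : ∃ q, K ≤ 8 * q + 2 ∧ q ≤ n * 2 ^ C.depth ∧
    ∀ A : ℕ → Finset V, Finset.univ.map inp ⊆ A 0 →
      (∀ r, ∀ u ∈ A r, u ∈ A (r + 1) ∧ ∀ v, G.Adj u v → v ∈ A (r + 1)) →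
      q ≤ ∑ r ∈ Finset.range C.depth, (A r).card

/-- The counting hypothesis is applied twice: to all gates, for the size, and to the cone gates, for
the depth. The condition `t ≠ s` rules out the circuit without gates, so that later the additive 2
can be absorbed even for tiny `n`. -/
theorem Circuit.demands_of_readsOff {C : Circuit G} {inp : Fin n ↪ V} {K : ℕ} {J : Type*}
    {s t : J → State (Fin n)} (hC : ∀ j, C.apply (withAncilla inp (s j)) = withAncilla inp (t j))
    (hst : t ≠ s)
    (h : ∀ l : List (Gate G), ReadsOff inp l (fun j => withAncilla inp (s j)) t →
      K ≤ 8 * l.length + 2) :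
    C.Demands inp K := by
  have hne : C.gateList ≠ [] := by
    intro h0
    refine hst (funext fun j => withAncilla_injective inp ?_)
    rw [← hC j, C.apply_eq_runGates, h0, runGates_nil]
  have hsize : 1 ≤ C.size := by
    rw [← C.length_gateList]
    exact List.length_pos_iff.2 hne
  refine ⟨?_, hsize, ?_, ?_⟩
  · refine List.length_pos_iff.2 ?_
    rintro rfl
    exact hne rfl
  · rw [← C.length_gateList]
    refine h _ (readsOff_of_factor (rest := []) (by simp) fun j => ?_)
    rw [← hC j, C.apply_eq_runGates, runGates_nil]
  · obtain ⟨k, r, h1, h2, h3, h4⟩ := C.exists_lightCone (Finset.univ.map inp)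
    refine ⟨k.length, h k (readsOff_of_factor (rest := r) (fun g hg q hq => ?_) fun j => ?_),
      by simpa using h3, h4⟩
    · exact Finset.disjoint_left.1 (h2 g hg) hq (by simp)
    · rw [← hC j, h1]

end Demands

/-! ### Target families of large dimension. -/

section Targets

variable {V : Type*} [DecidableEq V] [Fintype V] {n : ℕ}

lemma finrank_nonzero_strings (n : ℕ) :
    Module.finrank ℝ ({x : Fin n → Bool // x ≠ fun _ => false} → ℝ) = 2 ^ n - 1 := by
  simp [Fintype.card_subtype_compl]

lemma nonempty_interior_pi_Icc {ι : Type*} [Finite ι] {a : ℝ} (ha : 0 < a) :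
    (interior (Set.pi Set.univ fun _ : ι => Set.Icc (-a) a)).Nonempty := by
  rw [interior_pi_set Set.finite_univ]
  refine ⟨0, fun i _ => ?_⟩
  rw [interior_Icc]
  simpa using ha

/-- Phases with prescribed cosines on the nonzero strings. -/
noncomputable def phases (r : {x : Fin n → Bool // x ≠ fun _ => false} → ℝ)
    (x : Fin n → Bool) : ℝ :=
  open Classical in if h : x ≠ fun _ => false then Real.arccos (r ⟨x, h⟩) else 0

lemma phases_zero (r : {x : Fin n → Bool // x ≠ fun _ => false} → ℝ) :
    phases r (fun _ => false) = 0 := by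
  simp [phases]

lemma re_exp_phases {r : {x : Fin n → Bool // x ≠ fun _ => false} → ℝ}
    (hr : r ∈ Set.pi Set.univ fun _ => Set.Icc (-1 : ℝ) 1)
    (x : {x : Fin n → Bool // x ≠ fun _ => false}) :
    (Complex.exp (Complex.I * (phases r x : ℂ))).re = r x := by
  have := hr x (Set.mem_univ x)
  rw [mul_comm, Complex.exp_ofReal_mul_I_re, phases, dif_pos x.2,
    Real.cos_arccos this.1 this.2]

/-- The family consists of states with equal moduli and free phases. The real parts, rescaled by `a
= √(2^n)`, are the cosines of the phases and fill a cube. -/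
theorem exists_state_demands (G : SimpleGraph V) (hn : 1 ≤ n) (inp : Fin n ↪ V) :
    ∃ ψ : State (Fin n), ∑ x, ‖ψ x‖ ^ 2 = 1 ∧
      ∀ C : Circuit G, C.Prepares inp ψ → C.Demands inp (2 ^ n - 1) := by
  set a : ℝ := Real.sqrt (2 ^ n) with ha
  have ha0 : a ≠ 0 := by positivity
  let π : (Unit → State (Fin n)) → {x : Fin n → Bool // x ≠ fun _ => false} → ℝ :=
    fun t x => a * (t () x).re
  have hπ : ContDiff ℝ 1 π := by
    refine contDiff_pi.2 fun x => contDiff_const.mul (Complex.reCLM.contDiff.comp ?_)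
    fun_prop
  have hK : 0 < 2 ^ n - 1 := by
    have := Nat.one_lt_two_pow (n := n) (by omega)
    omega
  rw [← finrank_nonzero_strings] at hK ⊢
  obtain ⟨r, hr, hne, hread⟩ := exists_generic (G := G) inp
    (fun _ : Unit => withAncilla inp (ket fun _ => false)) hπ
    (nonempty_interior_pi_Icc one_pos) hK (π fun _ => ket fun _ => false)
  let ψ : State (Fin n) := fun x => (a : ℂ)⁻¹ * Complex.exp (Complex.I * (phases r x : ℂ))
  have hπψ : π (fun _ => ψ) = r := by
    funext x
    simp only [π, ψ, ← Complex.ofReal_inv, Complex.re_ofReal_mul, re_exp_phases hr]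
    rw [mul_inv_cancel_left₀ ha0]
  refine ⟨ψ, ?_, fun C hC => ?_⟩
  · have : ∀ x, ‖ψ x‖ ^ 2 = ((2 : ℝ) ^ n)⁻¹ := by
      intro x
      simp only [ψ, norm_mul, mul_comm Complex.I, Complex.norm_exp_ofReal_mul_I, norm_inv,
        Complex.norm_real, mul_one, inv_pow, Real.norm_eq_abs, sq_abs]
      rw [ha, Real.sq_sqrt (by positivity)]
    simp [this]
  · refine Circuit.demands_of_readsOff (s := fun _ : Unit => ket fun _ => false)
      (t := fun _ => ψ) (fun _ => hC) ?_ (hread _ hπψ)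
    intro h
    exact hne (by rw [← hπψ, h])

theorem exists_diagonal_demands (G : SimpleGraph V) (hn : 1 ≤ n) (inp : Fin n ↪ V) :
    ∃ θ : (Fin n → Bool) → ℝ, θ (fun _ => false) = 0 ∧
      ∀ C : Circuit G, C.Implements inp (diagUnitary θ) → C.Demands inp (2 ^ n - 1) := by
  let π : ((Fin n → Bool) → State (Fin n)) → {x : Fin n → Bool // x ≠ fun _ => false} → ℝ :=
    fun t x => (t x x).re
  have hπ : ContDiff ℝ 1 π := by
    refine contDiff_pi.2 fun x => Complex.reCLM.contDiff.comp ?_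
    fun_prop
  have hK : 0 < 2 ^ n - 1 := by
    have := Nat.one_lt_two_pow (n := n) (by omega)
    omega
  rw [← finrank_nonzero_strings] at hK ⊢
  obtain ⟨r, hr, hne, hread⟩ := exists_generic (G := G) inp
    (fun x : Fin n → Bool => withAncilla inp (ket x)) hπ
    (nonempty_interior_pi_Icc one_pos) hK (π ket)
  refine ⟨phases r, phases_zero r, fun C hC => ?_⟩
  have hπt : π (fun x => (diagUnitary (phases r)).mulVec (ket x)) = r := by
    funext x
    simp [π, diagUnitary, ket, re_exp_phases hr]
  refine Circuit.demands_of_readsOff (s := ket) hC ?_ (hread _ hπt)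
  intro h
  exact hne (by rw [← hπt, h])

-- For a contraction, `1 - star M * M` is a nonnegative element of a C⋆-algebra, hence of the form
-- `star B * B`.
open scoped ComplexOrder MatrixOrder Matrix.Norms.L2Operator in
lemma exists_one_sub_conjTranspose_mul_self_eq {β : Type*} [Fintype β] [DecidableEq β]
    {M : Matrix β β ℂ} (hM : ‖Matrix.toEuclideanCLM (𝕜 := ℂ) M‖ ≤ 1) :
    ∃ B : Matrix β β ℂ, 1 - star M * M = star B * B := by
  change ‖M‖ ≤ 1 at hM
  refine CStarAlgebra.nonneg_iff_eq_star_mul_self.1 (sub_nonneg.2 ?_)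
  rw [← CStarAlgebra.norm_le_one_iff_of_nonneg _ (star_mul_self_nonneg M),
    CStarRing.norm_star_mul_self]
  exact mul_le_one₀ hM (norm_nonneg _) hM

/-- Every contraction is the corner of a unitary matrix. -/
theorem exists_unitary_corner {α β : Type*} [Fintype α] [DecidableEq α] [Fintype β]
    [DecidableEq β] (e : β ⊕ β ≃ α) (M : Matrix β β ℂ)
    (hM : ‖Matrix.toEuclideanCLM (𝕜 := ℂ) M‖ ≤ 1) :
    ∃ U : Matrix.unitaryGroup α ℂ,
      ∀ i j, (U : Matrix α α ℂ) (e (.inl i)) (e (.inl j)) = M i j := by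
  obtain ⟨B, hB⟩ := exists_one_sub_conjTranspose_mul_self_eq hM
  -- Half of the columns are those of `M` stacked on `B`; the choice of `B` makes them orthonormal,
  -- and they extend to an orthonormal basis.
  let v : α → EuclideanSpace ℂ α := fun k =>
    WithLp.toLp 2 fun i => Sum.elim (fun j => Sum.elim (fun i => M i j) (fun i => B i j) (e.symm i))
      (fun _ => 0) (e.symm k)
  have hv : Orthonormal ℂ ((Set.range (e ∘ Sum.inl)).domRestrict v) := by
    rw [orthonormal_iff_ite]
    rintro ⟨_, j, rfl⟩ ⟨_, k, rfl⟩
    have hjk : (star M * M + star B * B) j k = (1 : Matrix β β ℂ) j k := by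
      rw [← hB, add_sub_cancel]
    simp only [Set.domRestrict_apply, v, PiLp.inner_apply, RCLike.inner_apply]
    rw [← e.sum_comp, Fintype.sum_sum_type]
    simpa [Matrix.mul_apply, Matrix.one_apply, mul_comm] using hjk
  obtain ⟨b, hb⟩ := hv.exists_orthonormalBasis_extension_of_card_eq (by simp)
  refine ⟨⟨Matrix.of fun i j => b j i, Matrix.mem_unitaryGroup_iff'.2 ?_⟩, fun i j => ?_⟩
  · ext i j
    have := orthonormal_iff_ite.1 b.orthonormal i j
    simpa [Matrix.mul_apply, Matrix.one_apply, PiLp.inner_apply, mul_comm] using this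
  · have := hb (e (.inl j)) ⟨j, rfl⟩
    simp [this, v]

lemma nonempty_interior_contractions (β : Type*) [Fintype β] [DecidableEq β] :
    (interior {M : β → β → ℂ |
      ‖Matrix.toEuclideanCLM (𝕜 := ℂ) (Matrix.of M)‖ ≤ 1}).Nonempty := by
  let T : (β → β → ℂ) →ₗ[ℂ] EuclideanSpace ℂ β →L[ℂ] EuclideanSpace ℂ β :=
    { toFun := fun M => Matrix.toEuclideanCLM (𝕜 := ℂ) (Matrix.of M)
      map_add' := fun M M' => map_add (Matrix.toEuclideanCLM (𝕜 := ℂ)) (Matrix.of M) (Matrix.of M')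
      map_smul' := fun c M => map_smul (Matrix.toEuclideanCLM (𝕜 := ℂ)) c (Matrix.of M) }
  have hT : Continuous T := T.continuous_of_finiteDimensional
  have hopen : IsOpen {M : β → β → ℂ | ‖T M‖ < 1} := isOpen_lt hT.norm continuous_const
  refine ⟨0, interior_maximal (fun M hM => ?_) hopen ?_⟩
  · exact le_of_lt (show ‖T M‖ < 1 from hM)
  · simp

/-- A corner block of half the size ranges over all contractions, a set with interior in a linear
space. This avoids charts on the unitary group and costs only a constant factor in the dimension. -/
theorem exists_unitary_demands (G : SimpleGraph V) (hn : 1 ≤ n) (inp : Fin n ↪ V) :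
    ∃ U : Matrix.unitaryGroup (Fin n → Bool) ℂ,
      ∀ C : Circuit G, C.Implements inp (U : Matrix (Fin n → Bool) (Fin n → Bool) ℂ) →
        C.Demands inp (2 * 4 ^ (n - 1)) := by
  obtain ⟨k, rfl⟩ := Nat.exists_eq_add_of_le' hn
  let β := Fin k → Bool
  let e : β ⊕ β ≃ (Fin (k + 1) → Bool) :=
    (Equiv.boolProdEquivSum β).symm.trans (Fin.consEquiv fun _ => Bool)
  let π : ((Fin (k + 1) → Bool) → State (Fin (k + 1))) → β → β → ℂ :=
    fun t i j => t (e (.inl j)) (e (.inl i))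
  have hπ : ContDiff ℝ 1 π := by
    refine contDiff_pi.2 fun i => contDiff_pi.2 fun j => ?_
    fun_prop
  have hE : Module.finrank ℝ (β → β → ℂ) = 2 * 4 ^ k := by
    simp [β, Module.finrank_pi_fintype, Complex.finrank_real_complex]
    rw [show 4 = 2 * 2 from rfl, mul_pow]
    ring
  have hR : (interior {M : β → β → ℂ |
      ‖Matrix.toEuclideanCLM (𝕜 := ℂ) (Matrix.of M)‖ ≤ 1}).Nonempty :=
    nonempty_interior_contractions β
  obtain ⟨r, hr, hne, hread⟩ := exists_generic (G := G) inp
    (fun x : Fin (k + 1) → Bool => withAncilla inp (ket x)) hπ hR (by rw [hE]; positivity) (π ket)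
  obtain ⟨U, hU⟩ := exists_unitary_corner e (Matrix.of r) hr
  refine ⟨U, fun C hC => ?_⟩
  have hπt : π (fun x => (U : Matrix _ _ ℂ).mulVec (ket x)) = r := by
    funext i j
    simp [π, ket, hU]
  rw [hE] at hread
  refine Circuit.demands_of_readsOff (s := ket) hC ?_ (hread _ hπt)
  intro h
  exact hne (by rw [← hπt, h])

end Targets

end QCircuit

namespace QCircuit

/-! ### Growth of the light cone in a grid. -/

section Bounds

variable {d n : ℕ} {N : Fin d → ℕ}

lemma lt_of_mem_inputCorner (hn : 1 ≤ n) (hN : 0 < ∏ i, N i) {x : GridVertex N}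
    (hx : x ∈ inputCorner N n) (i : Fin d) : (x i : ℕ) < n := by
  obtain ⟨k, a, hk, ha, hxa, hx0⟩ := hx
  have hpos : ∀ i, 0 < N i := fun i => by
    rw [Nat.pos_iff_ne_zero]
    exact fun h => hN.ne' (Finset.prod_eq_zero (Finset.mem_univ i) h)
  rcases lt_trichotomy i k with h | rfl | h
  · have h1 : ¬ n ≤ ∏ l ∈ Finset.Iic i, N l := fun h' => (hk.2 h').not_gt h
    have h2 : N i ≤ ∏ l ∈ Finset.Iic i, N l :=
      Finset.single_le_prod' (fun l _ => hpos l) (Finset.mem_Iic.2 le_rfl)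
    have := (x i).2
    omega
  · refine hxa.trans_le (ha.2 ?_)
    exact Nat.le_mul_of_pos_left _ (Finset.prod_pos fun l _ => hpos l)
  · rw [hx0 i h]
    exact hn

/-- The vertices of the grid all of whose coordinates are less than `a`. -/
def gridBox (N : Fin d → ℕ) (a : ℕ) : Finset (GridVertex N) :=
  Fintype.piFinset fun i => Finset.univ.filter fun x : Fin (N i) => (x : ℕ) < a

lemma mem_gridBox {a : ℕ} {x : GridVertex N} : x ∈ gridBox N a ↔ ∀ i, (x i : ℕ) < a := by
  simp [gridBox]

lemma mem_gridBox_of_adj {a : ℕ} {x y : GridVertex N} (hx : x ∈ gridBox N a)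
    (h : (gridGraph N).Adj x y) : y ∈ gridBox N (a + 1) := by
  rw [mem_gridBox] at hx ⊢
  obtain ⟨k, h1, h2⟩ := h
  intro i
  by_cases hik : i = k
  · subst hik
    have := hx i
    omega
  · rw [← h1 i hik]
    exact (hx i).trans (Nat.lt_succ_self a)

/-- The first `j` sides are bounded by `a`, the remaining ones by the grid itself. -/
lemma card_gridBox_le (a j : ℕ) (ha : 1 ≤ a) :
    (gridBox N a).card ≤ a ^ j * ∏ i ∈ Finset.univ.filter (fun i : Fin d => j ≤ (i : ℕ)), N i := by
  rw [gridBox, Fintype.card_piFinset,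
    ← Finset.prod_filter_mul_prod_filter_not _ fun i : Fin d => (i : ℕ) < j]
  simp only [not_lt]
  refine Nat.mul_le_mul ?_ (Finset.prod_le_prod' fun i _ => ?_)
  · refine (Finset.prod_le_pow_card _ _ a fun i _ => ?_).trans (Nat.pow_le_pow_right ha ?_)
    · have : ((Finset.univ.filter fun x : Fin (N i) => (x : ℕ) < a).map Fin.valEmbedding) ⊆
          Finset.range a := by
        intro x hx
        simp only [Finset.mem_map, Finset.mem_filter] at hx
        obtain ⟨y, ⟨-, hy⟩, rfl⟩ := hx
        exact Finset.mem_range.2 hy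
      simpa using Finset.card_le_card this
    · have : ((Finset.univ.filter fun i : Fin d => (i : ℕ) < j).map Fin.valEmbedding) ⊆
          Finset.range j := by
        intro x hx
        simp only [Finset.mem_map, Finset.mem_filter] at hx
        obtain ⟨y, ⟨-, hy⟩, rfl⟩ := hx
        exact Finset.mem_range.2 hy
      simpa using Finset.card_le_card this
  · exact (Finset.card_le_univ _).trans (by simp)

/-- If `n = 14D + s + 1`, then with `X = 2^D` and `Y = 2^(s+1)` the hypothesis gives `X^14·Y ≤
300·X^2·Y`, contradicting `X^12 ≥ 2^12`. -/
lemma le_of_two_pow_le {D : ℕ} (hD : 1 ≤ D) (h : 2 ^ n ≤ 20 * n * 2 ^ D) : n ≤ 14 * D := by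
  by_contra! hlt
  obtain ⟨s, rfl⟩ := Nat.exists_eq_add_of_lt hlt
  have h1 : D < 2 ^ D := Nat.lt_two_pow_self
  have h2 : s + 1 < 2 ^ (s + 1) := Nat.lt_two_pow_self
  have h3 : 2 ^ 12 ≤ (2 ^ D) ^ 12 := Nat.pow_le_pow_left (by omega) 12
  rw [add_assoc, pow_add, mul_comm 14 D, pow_mul] at h
  set X := 2 ^ D
  set Y := 2 ^ (s + 1)
  have h4 : D * 14 + (s + 1) ≤ 15 * (X * Y) := by nlinarith
  have h5 : X ^ 2 * Y * 2 ^ 12 ≤ X ^ 2 * Y * X ^ 12 := Nat.mul_le_mul_left _ h3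
  have h6 : 20 * (D * 14 + (s + 1)) * X ≤ 20 * (15 * (X * Y)) * X := by gcongr
  have h7 : 0 < X ^ 2 * Y := by positivity
  have h8 : X ^ 14 * Y = X ^ 2 * Y * X ^ 12 := by ring
  have h9 : 20 * (15 * (X * Y)) * X = 300 * (X ^ 2 * Y) := by ring
  omega

variable {inp : Fin n ↪ GridVertex N} {C : Circuit (gridGraph N)} {K : ℕ} {β : ℝ}

theorem Circuit.Demands.pow_le_size {V : Type*} [DecidableEq V] {G : SimpleGraph V}
    {inp : Fin n ↪ V} {C : Circuit G} (h : C.Demands inp K) (hK : β ^ n ≤ 2 * K) :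
    β ^ n ≤ 20 * C.size := by
  have h1 : (K : ℝ) ≤ 8 * C.size + 2 := by exact_mod_cast h.le_size
  have h2 : (1 : ℝ) ≤ C.size := by exact_mod_cast h.one_le_size
  linarith

theorem Circuit.Demands.le_depth {V : Type*} [DecidableEq V] {G : SimpleGraph V}
    {inp : Fin n ↪ V} {C : Circuit G} (h : C.Demands inp K) (hn : 1 ≤ n) (hβ : 2 ≤ β)
    (hK : β ^ n ≤ 2 * K) : n ≤ 14 * C.depth := by
  obtain ⟨q, h1, h2, -⟩ := h.le_cone
  refine le_of_two_pow_le h.one_le_depth ?_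
  have h3 : (2 : ℝ) ^ n ≤ β ^ n := by gcongr
  have h4 : 2 ^ n ≤ 2 * K := by exact_mod_cast h3.trans hK
  have h5 : 1 ≤ n * 2 ^ C.depth := Nat.mul_pos hn (by positivity)
  rw [mul_assoc]
  omega

theorem Circuit.Demands.pow_le_depth (h : C.Demands inp K) (hn : 1 ≤ n) (hβ : 2 ≤ β)
    (hK : β ^ n ≤ 2 * K) (hN : 0 < ∏ i, N i) (hinp : ∀ q, inp q ∈ inputCorner N n) (j : ℕ) :
    β ^ n ≤ (20 * C.depth : ℝ) ^ (j + 1) * ∏ i ∈ Finset.univ.filter (fun i : Fin d => j ≤ (i : ℕ)), (N i : ℝ) := by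
  obtain ⟨q, h1, -, h2⟩ := h.le_cone
  have hD := h.one_le_depth
  have hnD := h.le_depth hn hβ hK
  set D := C.depth
  set P := ∏ i ∈ Finset.univ.filter (fun i : Fin d => j ≤ (i : ℕ)), N i with hP
  have hP1 : 1 ≤ P := Finset.prod_pos fun i _ => by
    rw [Nat.pos_iff_ne_zero]
    exact fun h => hN.ne' (Finset.prod_eq_zero (Finset.mem_univ i) h)
  have h3 : q ≤ ∑ r ∈ Finset.range D, (gridBox N (n + r)).card := by
    refine h2 (fun r => gridBox N (n + r)) ?_ fun r u hu =>
      ⟨?_, fun v huv => mem_gridBox_of_adj hu huv⟩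
    · intro v hv
      obtain ⟨q, -, rfl⟩ := Finset.mem_map.1 hv
      exact mem_gridBox.2 (lt_of_mem_inputCorner hn hN (hinp q))
    · exact mem_gridBox.2 fun i => (mem_gridBox.1 hu i).trans (Nat.lt_succ_self _)
  have h4 : q ≤ D * ((15 * D) ^ j * P) := by
    refine h3.trans ((Finset.sum_le_card_nsmul _ _ ((15 * D) ^ j * P) fun r hr => ?_).trans
      (by simp))
    have hr' := Finset.mem_range.1 hr
    refine (card_gridBox_le (n + r) j (by omega)).trans (Nat.mul_le_mul_right _ ?_)
    -- Here `n + r ≤ 15D`, from `n ≤ 14D` and `r < D`.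
    exact Nat.pow_le_pow_left (by omega) j
  have h5 : D * ((15 * D) ^ j * P) ≤ D * ((20 * D) ^ j * P) := by
    gcongr
    norm_num
  have h6 : 1 ≤ D * ((20 * D) ^ j * P) := by
    refine Nat.mul_pos hD (Nat.mul_pos (by positivity) hP1)
  -- `2K ≤ 16q + 4`, and the 4 is absorbed because the product is at least 1.
  have h7 : 2 * K ≤ 20 * (D * ((20 * D) ^ j * P)) := by omega
  calc β ^ n ≤ 2 * K := hK
    _ ≤ ((20 * (D * ((20 * D) ^ j * P)) : ℕ) : ℝ) := by exact_mod_cast h7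
    _ = _ := by push_cast [hP]; ring

lemma rpow_div_le {Y P : ℝ} {j : ℕ} (hβ : 0 ≤ β) (hY : 0 ≤ Y) (hP : 0 < P)
    (h : β ^ n ≤ Y ^ (j + 1) * P) :
    β ^ ((n : ℝ) / ((j : ℝ) + 1)) / P ^ (1 / ((j : ℝ) + 1)) ≤ Y := by
  have hj : ((j : ℝ) + 1) ≠ 0 := by positivity
  rw [div_le_iff₀ (by positivity)]
  calc β ^ ((n : ℝ) / ((j : ℝ) + 1)) = (β ^ n) ^ (1 / ((j : ℝ) + 1)) := by
        rw [← Real.rpow_natCast β n, ← Real.rpow_mul hβ, mul_one_div]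
    _ ≤ (Y ^ (j + 1) * P) ^ (1 / ((j : ℝ) + 1)) := by gcongr
    _ = Y * P ^ (1 / ((j : ℝ) + 1)) := by
        rw [Real.mul_rpow (by positivity) hP.le, ← Real.rpow_natCast Y (j + 1),
          ← Real.rpow_mul hY]
        push_cast
        rw [mul_one_div, div_self hj, Real.rpow_one]

/-- The three kinds of terms in the depth bounds. -/
theorem Circuit.Demands.rpow_le_depth (h : C.Demands inp K) (hn : 1 ≤ n) (hβ : 2 ≤ β)
    (hK : β ^ n ≤ 2 * K) (hN : 0 < ∏ i, N i) (hinp : ∀ q, inp q ∈ inputCorner N n) :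
    β ^ ((n : ℝ) / ((d : ℝ) + 1)) ≤ 20 * C.depth ∧
    ∀ j : Fin d, β ^ ((n : ℝ) / ((j : ℝ) + 1)) /
      (∏ i ∈ Finset.Ici j, (N i : ℝ)) ^ (1 / ((j : ℝ) + 1)) ≤ 20 * C.depth := by
  have hpos : ∀ i, 0 < N i := fun i => by
    rw [Nat.pos_iff_ne_zero]
    exact fun h => hN.ne' (Finset.prod_eq_zero (Finset.mem_univ i) h)
  have key := h.pow_le_depth hn hβ hK hN hinp
  constructor
  · have h1 := key d
    -- For `j = d` no grid side is left in the product, so the bound does not depend on the grid's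
    -- size.
    rw [Finset.filter_false_of_mem fun i _ => by have := i.2; omega, Finset.prod_empty] at h1
    simpa using rpow_div_le (by linarith) (by positivity) one_pos h1
  · intro j
    refine rpow_div_le (by linarith) (by positivity)
      (Finset.prod_pos fun i _ => by exact_mod_cast hpos i) ?_
    have : Finset.Ici j = Finset.univ.filter fun i : Fin d => (j : ℕ) ≤ i := by
      ext i; simp
    rw [this]
    exact key j

theorem Circuit.Demands.gridBound_le (h : C.Demands inp K) (hd : 1 ≤ d) (hn : 1 ≤ n)
    (hβ : 2 ≤ β) (hK : β ^ n ≤ 2 * K) (hN : 0 < ∏ i, N i)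
    (hinp : ∀ q, inp q ∈ inputCorner N n) : 1 / 60 * gridBound β N n ≤ C.depth := by
  obtain ⟨h1, h2⟩ := h.rpow_le_depth hn hβ hK hN hinp
  have h3 : (n : ℝ) ≤ 14 * C.depth := by exact_mod_cast h.le_depth hn hβ hK
  have : Nonempty (Fin d) := ⟨⟨0, hd⟩⟩
  have h4 := ciSup_le h2
  rw [gridBound]
  have : (0 : ℝ) ≤ C.depth := by positivity
  linarith

theorem Circuit.Demands.grid_two_le {n₁ n₂ m : ℕ} {inp : Fin n ↪ GridVertex ![n₁, n₂]}
    {C : Circuit (gridGraph ![n₁, n₂])} (h : C.Demands inp K) (hn : 1 ≤ n) (hβ : 2 ≤ β)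
    (hK : β ^ n ≤ 2 * K) (hN : n₁ * n₂ = n + m)
    (hinp : ∀ q, inp q ∈ inputCorner ![n₁, n₂] n) :
    1 / 60 * (β ^ ((n : ℝ) / 3) + β ^ ((n : ℝ) / 2) / Real.sqrt n₂ + β ^ n / ((n : ℝ) + m)) ≤
      C.depth := by
  obtain ⟨h1, h2⟩ := h.rpow_le_depth hn hβ hK (by simp [hN]; omega) hinp
  have h3 := h2 0
  have h4 := h2 1
  have e1 : (Finset.Ici (1 : Fin 2)) = {1} := rfl
  have e0 : (Finset.Ici (0 : Fin 2)) = {0, 1} := rfl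
  have hN' : (n₁ : ℝ) * n₂ = n + m := by exact_mod_cast hN
  norm_num [e1, e0, hN', ← Real.sqrt_eq_rpow] at h1 h3 h4
  linarith

theorem Circuit.Demands.path_le {m : ℕ} {inp : Fin n ↪ GridVertex ![n + m]}
    {C : Circuit (gridGraph ![n + m])} (h : C.Demands inp K) (hn : 1 ≤ n) (hβ : 2 ≤ β)
    (hK : β ^ n ≤ 2 * K) (hinp : ∀ q, inp q ∈ inputCorner ![n + m] n) :
    1 / 60 * (β ^ ((n : ℝ) / 2) + β ^ n / ((n : ℝ) + m)) ≤ C.depth := by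
  obtain ⟨h1, h2⟩ := h.rpow_le_depth hn hβ hK (by simp; omega) hinp
  have h3 := h2 0
  have e0 : (Finset.Ici (0 : Fin 1)) = {0} := rfl
  norm_num [e0] at h1 h3
  linarith [show (0 : ℝ) ≤ C.depth by positivity]

lemma two_pow_le_dimension (hn : 1 ≤ n) : (2 : ℝ) ^ n ≤ 2 * ((2 ^ n - 1 : ℕ) : ℝ) := by
  have := Nat.one_lt_two_pow (n := n) (by omega)
  exact_mod_cast (by omega : 2 ^ n ≤ 2 * (2 ^ n - 1))

lemma four_pow_le_dimension (hn : 1 ≤ n) :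
    (4 : ℝ) ^ n ≤ 2 * ((2 * 4 ^ (n - 1) : ℕ) : ℝ) := by
  obtain ⟨k, rfl⟩ := Nat.exists_eq_add_of_le' hn
  push_cast
  rw [pow_succ]
  linarith

end Bounds

/-! ### From resource demands to lower bounds. -/

section Needs

variable {V : Type*} [DecidableEq V] [Fintype V] {G : SimpleGraph V} {n : ℕ} {inp : Fin n ↪ V}
  {cost : Circuit G → ℕ} {b : ℝ}

theorem someStateNeeds_of_demands (hn : 1 ≤ n)
    (h : ∀ C : Circuit G, ∀ K : ℕ, (2 : ℝ) ^ n ≤ 2 * K → C.Demands inp K → b ≤ cost C) :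
    SomeStateNeeds G inp cost b := by
  obtain ⟨ψ, h1, h2⟩ := exists_state_demands G hn inp
  exact ⟨ψ, h1, fun C hC => h C _ (two_pow_le_dimension hn) (h2 C hC)⟩

theorem someDiagonalNeeds_of_demands (hn : 1 ≤ n)
    (h : ∀ C : Circuit G, ∀ K : ℕ, (2 : ℝ) ^ n ≤ 2 * K → C.Demands inp K → b ≤ cost C) :
    SomeDiagonalNeeds G inp cost b := by
  obtain ⟨θ, h1, h2⟩ := exists_diagonal_demands G hn inp
  exact ⟨θ, h1, fun C hC => h C _ (two_pow_le_dimension hn) (h2 C hC)⟩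

theorem someUnitaryNeeds_of_demands (hn : 1 ≤ n)
    (h : ∀ C : Circuit G, ∀ K : ℕ, (4 : ℝ) ^ n ≤ 2 * K → C.Demands inp K → b ≤ cost C) :
    SomeUnitaryNeeds G inp cost b := by
  obtain ⟨U, h2⟩ := exists_unitary_demands G hn inp
  exact ⟨U, fun C hC => h C _ (four_pow_le_dimension hn) (h2 C hC)⟩

end Needs

end QCircuit

theorem mainTheorem10 :
    ∃ c : ℝ, 0 < c ∧
      -- general grids
      (∀ (d n m : ℕ) (N : Fin d → ℕ), 1 ≤ d → 1 ≤ n → Antitone N → ∏ i, N i = n + m →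
        ∀ inp : Fin n ↪ QCircuit.GridVertex N, (∀ q, inp q ∈ QCircuit.inputCorner N n) →
          QCircuit.SomeStateNeeds (QCircuit.gridGraph N) inp QCircuit.Circuit.depth
              (c * QCircuit.gridBound 2 N n) ∧
          QCircuit.SomeDiagonalNeeds (QCircuit.gridGraph N) inp QCircuit.Circuit.depth
              (c * QCircuit.gridBound 2 N n) ∧
          QCircuit.SomeUnitaryNeeds (QCircuit.gridGraph N) inp QCircuit.Circuit.depth
              (c * QCircuit.gridBound 4 N n)) ∧
      -- two-dimensional grids
      (∀ (n m n₁ n₂ : ℕ), 1 ≤ n → n₂ ≤ n₁ → n₁ * n₂ = n + m →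
        ∀ inp : Fin n ↪ QCircuit.GridVertex ![n₁, n₂],
          (∀ q, inp q ∈ QCircuit.inputCorner ![n₁, n₂] n) →
          QCircuit.SomeStateNeeds (QCircuit.gridGraph ![n₁, n₂]) inp QCircuit.Circuit.depth
              (c * ((2 : ℝ) ^ ((n : ℝ) / 3) + (2 : ℝ) ^ ((n : ℝ) / 2) / Real.sqrt n₂ +
                (2 : ℝ) ^ n / ((n : ℝ) + m))) ∧
          QCircuit.SomeDiagonalNeeds (QCircuit.gridGraph ![n₁, n₂]) inp QCircuit.Circuit.depth
              (c * ((2 : ℝ) ^ ((n : ℝ) / 3) + (2 : ℝ) ^ ((n : ℝ) / 2) / Real.sqrt n₂ +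
                (2 : ℝ) ^ n / ((n : ℝ) + m))) ∧
          QCircuit.SomeUnitaryNeeds (QCircuit.gridGraph ![n₁, n₂]) inp QCircuit.Circuit.depth
              (c * ((4 : ℝ) ^ ((n : ℝ) / 3) + (4 : ℝ) ^ ((n : ℝ) / 2) / Real.sqrt n₂ +
                (4 : ℝ) ^ n / ((n : ℝ) + m)))) ∧
      -- paths: depth and size
      (∀ (n m : ℕ), 1 ≤ n →
        ∀ inp : Fin n ↪ QCircuit.GridVertex ![n + m],
          (∀ q, inp q ∈ QCircuit.inputCorner ![n + m] n) →
          QCircuit.SomeStateNeeds (QCircuit.gridGraph ![n + m]) inp QCircuit.Circuit.depth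
              (c * ((2 : ℝ) ^ ((n : ℝ) / 2) + (2 : ℝ) ^ n / ((n : ℝ) + m))) ∧
          QCircuit.SomeStateNeeds (QCircuit.gridGraph ![n + m]) inp QCircuit.Circuit.size
              (c * (2 : ℝ) ^ n) ∧
          QCircuit.SomeDiagonalNeeds (QCircuit.gridGraph ![n + m]) inp QCircuit.Circuit.depth
              (c * ((2 : ℝ) ^ ((n : ℝ) / 2) + (2 : ℝ) ^ n / ((n : ℝ) + m))) ∧
          QCircuit.SomeDiagonalNeeds (QCircuit.gridGraph ![n + m]) inp QCircuit.Circuit.size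
              (c * (2 : ℝ) ^ n) ∧
          QCircuit.SomeUnitaryNeeds (QCircuit.gridGraph ![n + m]) inp QCircuit.Circuit.depth
              (c * ((2 : ℝ) ^ n + (4 : ℝ) ^ n / ((n : ℝ) + m))) ∧
          QCircuit.SomeUnitaryNeeds (QCircuit.gridGraph ![n + m]) inp QCircuit.Circuit.size
              (c * (4 : ℝ) ^ n)) := by
  -- Each depth bound has at most three terms, each at most `20·depth`.
  refine ⟨1 / 60, by norm_num, ?_, ?_, ?_⟩
  · intro d n m N hd hn _ hN inp hinp
    have hpos : 0 < ∏ i, N i := by omega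
    exact ⟨QCircuit.someStateNeeds_of_demands hn fun C K hK h =>
        h.gridBound_le hd hn le_rfl hK hpos hinp,
      QCircuit.someDiagonalNeeds_of_demands hn fun C K hK h =>
        h.gridBound_le hd hn le_rfl hK hpos hinp,
      QCircuit.someUnitaryNeeds_of_demands hn fun C K hK h =>
        h.gridBound_le hd hn (by norm_num) hK hpos hinp⟩
  · intro n m n₁ n₂ hn _ hN inp hinp
    exact ⟨QCircuit.someStateNeeds_of_demands hn fun C K hK h =>
        h.grid_two_le hn le_rfl hK hN hinp,
      QCircuit.someDiagonalNeeds_of_demands hn fun C K hK h =>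
        h.grid_two_le hn le_rfl hK hN hinp,
      QCircuit.someUnitaryNeeds_of_demands hn fun C K hK h =>
        h.grid_two_le hn (by norm_num) hK hN hinp⟩
  · intro n m hn inp hinp
    have hsize : ∀ {β : ℝ} (C : QCircuit.Circuit (QCircuit.gridGraph ![n + m])) (K : ℕ),
        β ^ n ≤ 2 * K → C.Demands inp K → 1 / 60 * β ^ n ≤ C.size := fun C K hK h => by
      have := h.pow_le_size hK
      linarith [show (0 : ℝ) ≤ C.size by positivity]
    -- Converts the `β = 4` term of the path bound to the stated form.
    have hfour : (4 : ℝ) ^ ((n : ℝ) / 2) = 2 ^ n := by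
      rw [show (4 : ℝ) = 2 ^ (2 : ℝ) by norm_num, ← Real.rpow_mul (by norm_num),
        mul_div_cancel₀ _ (by norm_num), Real.rpow_natCast]
    refine ⟨QCircuit.someStateNeeds_of_demands hn fun C K hK h =>
        h.path_le hn le_rfl hK hinp,
      QCircuit.someStateNeeds_of_demands hn hsize,
      QCircuit.someDiagonalNeeds_of_demands hn fun C K hK h =>
        h.path_le hn le_rfl hK hinp,
      QCircuit.someDiagonalNeeds_of_demands hn hsize,
      QCircuit.someUnitaryNeeds_of_demands hn fun C K hK h => ?_,
      QCircuit.someUnitaryNeeds_of_demands hn hsize⟩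
    rw [← hfour]
    exact h.path_le hn (by norm_num) hK hinp
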